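/- Let $(X,d)$ be a metric space and let $n\ge 0$ be an integer. A family of subsets of $X$ is *$r$-disjoint* if $d(x,y)\ge r$ whenever $x\in U$ and $y\in V$ for distinct members $U\neq V$ of the family. For an integer $k\ge 0$, the *capacity dimension* of $X$ (respectively, the *asymptotic dimension with Higson property* of $X$) is at most $k$ if there is a constant $C>0$ such that for all sufficiently small $r>0$ (respectively, for all sufficiently large $r$) there is a cover $\mathcal U=\bigcup_{i=1}^{k+1}\mathcal U_i$ of $X$ such that each $\mathcal U_i$ is $r$-disjoint and every element of $\mathcal U$ has diameter at most $C\cdot r$; the dimension is finite if it is at most $k$ for some $k$. A metric space $E$ is a *small scale* (respectively, *large scale*) *Lipschitz extensor* of $X$ if there are constants $C,M>0$ such that for every $\lambda>M$ (respectively, every $0\le\lambda<M$), every subset $A\subseteq X$ and every $\lambda$-Lipschitz function $f:A\to E$, there is a $C\lambda$-Lipschitz function $\tilde f:X\to E$ extending $f$. Let $S^n$ be the unit sphere of $\mathbb R^{n+1}$ with the Euclidean metric. **Theorem.** Suppose $X$ is a metric space of finite capacity dimension (respectively, of finite asymptotic dimension with Higson property). If $n\ge 0$, then the following conditions are equivalent: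 (a) $S^n$ is a small scale (respectively, large scale) Lipschitz extensor of $X$. (b) The capacity dimension (respectively, the asymptotic dimension with Higson property) of $X$ is at most $n$. -/

import Mathlib

/-- A family `𝒰` of subsets of a metric space is `r`-disjoint if points lying in two different
members of `𝒰` are at distance at least `r`. -/
def IsRDisjointFamily {X : Type*} [MetricSpace X] (r : ℝ) (𝒰 : Set (Set X)) : Prop :=
  ∀ U ∈ 𝒰, ∀ V ∈ 𝒰, U ≠ V → ∀ x ∈ U, ∀ y ∈ V, r ≤ dist x y

/-- At the scale `r`, the space `X` has a cover that is the union of `n + 1` families, each of them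
`r`-disjoint, and all of whose members have diameter at most `D`. -/
def HasColoredCover (X : Type*) [MetricSpace X] (n : ℕ) (r D : ℝ) : Prop :=
  ∃ 𝒰 : Fin (n + 1) → Set (Set X),
    (∀ x : X, ∃ i, ∃ U ∈ 𝒰 i, x ∈ U) ∧
    (∀ i, IsRDisjointFamily r (𝒰 i)) ∧
    (∀ i, ∀ U ∈ 𝒰 i, ∀ x ∈ U, ∀ y ∈ U, dist x y ≤ D)

/-- The capacity dimension of `X` is at most `n`. -/
def CapacityDimLE (X : Type*) [MetricSpace X] (n : ℕ) : Prop :=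
  ∃ C : ℝ, 0 < C ∧ ∃ r₀ : ℝ, 0 < r₀ ∧ ∀ r : ℝ, 0 < r → r < r₀ → HasColoredCover X n r (C * r)

/-- The asymptotic dimension of `X` with the Higson property (also called asymptotic dimension of
linear type) is at most `n`. -/
def HigsonAsdimLE (X : Type*) [MetricSpace X] (n : ℕ) : Prop :=
  ∃ C : ℝ, 0 < C ∧ ∃ r₀ : ℝ, 0 < r₀ ∧ ∀ r : ℝ, r₀ < r → HasColoredCover X n r (C * r)

open scoped NNReal in
/-- Every `l`-Lipschitz map from a subset of `X` to `E` extends to a `C * l`-Lipschitz map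
from `X` to `E`. -/
def LipschitzExtendsAt (X E : Type*) [MetricSpace X] [MetricSpace E] (C l : ℝ≥0) : Prop :=
  ∀ (A : Set X) (f : A → E), LipschitzWith l f →
    ∃ g : X → E, LipschitzWith (C * l) g ∧ ∀ a : A, g a = f a

open scoped NNReal in
/-- `E` is a small scale Lipschitz extensor of `X`. -/
def IsSmallScaleLipschitzExtensor (E X : Type*) [MetricSpace E] [MetricSpace X] : Prop :=
  ∃ C M : ℝ≥0, 0 < C ∧ 0 < M ∧ ∀ l : ℝ≥0, M < l → LipschitzExtendsAt X E C l

open scoped NNReal in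
/-- `E` is a large scale Lipschitz extensor of `X`. -/
def IsLargeScaleLipschitzExtensor (E X : Type*) [MetricSpace E] [MetricSpace X] : Prop :=
  ∃ C M : ℝ≥0, 0 < C ∧ 0 < M ∧ ∀ l : ℝ≥0, l < M → LipschitzExtendsAt X E C l

/-- The unit sphere `S^n` of Euclidean `(n + 1)`-space, with the metric induced by the
Euclidean one. -/
abbrev UnitSphere (n : ℕ) : Type :=
  Metric.sphere (0 : EuclideanSpace ℝ (Fin (n + 1))) 1

/-!
From covers to extensions: a map from `A` to the sphere extends to a Lipschitz map `F` into the
ball. At a fine enough scale, `F` is approximated by a map that averages, with the weights of the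
`n + 1` colors, the values of `F` at nearby centers, each rounded to a small lattice. The color
fixes the parities of the rounded value, so that the `n + 1` rounded values form an integral matrix
of odd determinant. They are hence quantitatively linearly independent, which plays the role of
general position: the averages stay away from `0`. Away from `A` the approximation replaces `F`,
and the resulting map can be normalized.

From extensions to covers: the sphere being a suspension, an extensor property of `S^n` passes to
the higher spheres, and one may remove one color at a time. From a cover with `k + 2` colors, the
zero-sum part of the weight vector gives a map to `S^k` on the set where some weight vanishes. An
extension to `X` is a unit vector with zero coordinate sum at each point, so its sorted coordinates
have a definite gap. The set of coordinates above the gap has between `1` and `k + 1` elements, and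
its cardinality is the new color.
-/

open Filter Set Topology
open scoped NNReal

theorem lipschitzWith_sum {ι X V : Type*} [PseudoMetricSpace X] [SeminormedAddCommGroup V]
    {s : Finset ι} {K : ι → ℝ≥0} {f : ι → X → V}
    (hf : ∀ i ∈ s, LipschitzWith (K i) (f i)) :
    LipschitzWith (∑ i ∈ s, K i) fun x => ∑ i ∈ s, f i x := by
  refine LipschitzWith.of_dist_le_mul fun x y => ?_
  rw [NNReal.coe_sum, Finset.sum_mul]
  exact dist_sum_sum_le_of_le s fun i hi => (hf i hi).dist_le_mul x y

section NormedSpace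

variable {V : Type*} [NormedAddCommGroup V] [NormedSpace ℝ V]

theorem norm_inv_smul_sub_inv_smul_le {m R s t : ℝ} {v w : V} (hm : 0 < m) (hs : m ≤ s)
    (ht : m ≤ t) (hw : ‖w‖ ≤ R * t) :
    ‖s⁻¹ • v - t⁻¹ • w‖ ≤ m⁻¹ * (‖v - w‖ + R * |s - t|) := by
  have hs₀ : 0 < s := hm.trans_le hs
  have ht₀ : 0 < t := hm.trans_le ht
  have hsplit : s⁻¹ • v - t⁻¹ • w = s⁻¹ • ((v - w) + ((t - s) * t⁻¹) • w) := by
    have : s⁻¹ * ((t - s) * t⁻¹) = s⁻¹ - t⁻¹ := by field_simp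
    rw [smul_add, smul_smul, this]
    module
  have hw' : ‖((t - s) * t⁻¹) • w‖ ≤ R * |s - t| := by
    rw [norm_smul, norm_mul, norm_inv, Real.norm_of_nonneg ht₀.le, Real.norm_eq_abs,
      abs_sub_comm]
    calc |s - t| * t⁻¹ * ‖w‖ ≤ |s - t| * t⁻¹ * (R * t) := by gcongr
      _ = R * |s - t| := by field_simp
  rw [hsplit, norm_smul, norm_inv, Real.norm_of_nonneg hs₀.le]
  gcongr
  exact (norm_add_le _ _).trans (by gcongr)

theorem lipschitzOnWith_normalize {m : ℝ≥0} (hm : 0 < m) :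
    LipschitzOnWith (2 / m) (NormedSpace.normalize : V → V) {v | m ≤ ‖v‖} := by
  refine LipschitzOnWith.of_dist_le_mul fun v hv w hw => ?_
  rw [dist_eq_norm, dist_eq_norm]
  calc ‖NormedSpace.normalize v - NormedSpace.normalize w‖
      ≤ (m : ℝ)⁻¹ * (‖v - w‖ + 1 * |‖v‖ - ‖w‖|) :=
        norm_inv_smul_sub_inv_smul_le hm hv hw (one_mul _).ge
    _ ≤ (m : ℝ)⁻¹ * (‖v - w‖ + 1 * ‖v - w‖) := by gcongr; exact abs_norm_sub_norm_le v w
    _ = (2 / m : ℝ≥0) * ‖v - w‖ := by push_cast; ring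

theorem lipschitzWith_inv_max_norm_smul :
    LipschitzWith 2 fun v : V => (max ‖v‖ 1)⁻¹ • v := by
  refine LipschitzWith.of_dist_le_mul fun v w => ?_
  have hmax : |max ‖v‖ 1 - max ‖w‖ 1| ≤ ‖v - w‖ :=
    (abs_max_sub_max_le_abs _ _ _).trans (abs_norm_sub_norm_le v w)
  rw [dist_eq_norm, dist_eq_norm]
  calc ‖(max ‖v‖ 1)⁻¹ • v - (max ‖w‖ 1)⁻¹ • w‖
      ≤ 1⁻¹ * (‖v - w‖ + 1 * |max ‖v‖ 1 - max ‖w‖ 1|) :=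
        norm_inv_smul_sub_inv_smul_le one_pos (le_max_right _ _) (le_max_right _ _)
          ((le_max_left _ _).trans_eq (one_mul _).symm)
    _ ≤ (2 : ℝ≥0) * ‖v - w‖ := by push_cast; linarith

theorem norm_inv_max_norm_smul_le_one (v : V) : ‖(max ‖v‖ 1)⁻¹ • v‖ ≤ 1 := by
  have hmax : 0 < max ‖v‖ 1 := lt_max_of_lt_right one_pos
  rw [norm_smul, norm_inv, Real.norm_of_nonneg hmax.le, inv_mul_le_one₀ hmax]
  exact le_max_left _ _

variable {X : Type*} [PseudoMetricSpace X]

theorem lipschitzWith_smul_of_norm_le {φ : X → ℝ} {f : X → V} {Kφ Kf a b : ℝ≥0}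
    (hφ : LipschitzWith Kφ φ) (hf : LipschitzWith Kf f) (hφa : ∀ x, ‖φ x‖ ≤ a)
    (hfb : ∀ x, ‖f x‖ ≤ b) : LipschitzWith (a * Kf + Kφ * b) fun x => φ x • f x := by
  refine LipschitzWith.of_dist_le_mul fun x y => ?_
  rw [dist_eq_norm]
  calc ‖φ x • f x - φ y • f y‖ = ‖φ x • (f x - f y) + (φ x - φ y) • f y‖ := by congr 1; module
    _ ≤ ‖φ x‖ * ‖f x - f y‖ + ‖φ x - φ y‖ * ‖f y‖ := by
      simpa only [norm_smul] using norm_add_le (φ x • (f x - f y)) ((φ x - φ y) • f y)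
    _ ≤ a * (Kf * dist x y) + Kφ * dist x y * b := by
      gcongr
      · exact hφa x
      · simpa only [dist_eq_norm] using hf.dist_le_mul x y
      · simpa only [dist_eq_norm] using hφ.dist_le_mul x y
      · exact hfb y
    _ = (a * Kf + Kφ * b : ℝ≥0) * dist x y := by push_cast; ring

theorem lipschitzWith_lineMap_of_norm_sub_le {χ : X → ℝ} {f g : X → V} {Kχ Kf Kg b : ℝ≥0}
    (hχ : LipschitzWith Kχ χ) (hf : LipschitzWith Kf f) (hg : LipschitzWith Kg g)
    (hχ₁ : ∀ x, ‖χ x‖ ≤ 1) (hfg : ∀ x, ‖g x - f x‖ ≤ b) :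
    LipschitzWith (2 * Kf + Kg + Kχ * b) fun x => AffineMap.lineMap (f x) (g x) (χ x) := by
  have hsmul := lipschitzWith_smul_of_norm_le (a := 1) hχ (hg.sub hf) (by simpa using hχ₁) hfg
  simp only [AffineMap.lineMap_apply_module']
  exact (hsmul.add hf).weaken (le_of_eq (by ring))

/-- The radial retraction onto the unit ball keeps an extension of `f` within the ball. -/
theorem exists_lipschitzWith_extension_norm_le_one [FiniteDimensional ℝ V] {l : ℝ≥0} {A : Set X}
    {f : A → Metric.sphere (0 : V) 1} (hf : LipschitzWith l f) :
    ∃ F : X → V, LipschitzWith (2 * lipschitzExtensionConstant V * l) F ∧ (∀ x, ‖F x‖ ≤ 1) ∧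
      ∀ a : A, F a = f a := by
  let f₀ : X → V := Function.extend Subtype.val (fun a => (f a : V)) 0
  have hf₀ (a : A) : f₀ a = f a := Subtype.val_injective.extend_apply _ _ a
  have hf₀_lip : LipschitzOnWith l f₀ A := by
    rw [lipschitzOnWith_iff_restrict, show A.domRestrict f₀ = fun a => (f a : V) from funext hf₀]
    simpa only [one_mul, Function.comp_def] using (LipschitzWith.subtype_val _).comp hf
  obtain ⟨G, hG, hGf⟩ := hf₀_lip.extend_finite_dimension
  refine ⟨fun x => (max ‖G x‖ 1)⁻¹ • G x, ?_, fun x => norm_inv_max_norm_smul_le_one _,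
    fun a => ?_⟩
  · exact (lipschitzWith_inv_max_norm_smul.comp hG).weaken (mul_assoc _ _ _).ge
  · have hGa : G a = f a := (hGf a.2).symm.trans (hf₀ a)
    simp only [hGa, norm_eq_of_mem_sphere, max_self, inv_one, one_smul]

theorem exists_sphere_extension_of_le_norm {K m : ℝ≥0} {A : Set X}
    {f : A → Metric.sphere (0 : V) 1} {G : X → V} (hm : 0 < m) (hG : LipschitzWith K G)
    (hGm : ∀ x, m ≤ ‖G x‖) (hGf : ∀ a : A, G a = f a) :
    ∃ g : X → Metric.sphere (0 : V) 1, LipschitzWith (2 / m * K) g ∧ ∀ a : A, g a = f a := by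
  have hG₀ (x : X) : G x ≠ 0 := norm_pos_iff.1 ((NNReal.coe_pos.2 hm).trans_le (hGm x))
  have hlip : LipschitzWith (2 / m * K) fun x => NormedSpace.normalize (G x) :=
    lipschitzOnWith_univ.1 <|
      (lipschitzOnWith_normalize hm).comp hG.lipschitzOnWith fun x _ => hGm x
  have hsphere (x : X) : NormedSpace.normalize (G x) ∈ Metric.sphere (0 : V) 1 := by
    simpa using hG₀ x
  refine ⟨fun x => ⟨_, hsphere x⟩, hlip.subtype_mk hsphere, fun a => ?_⟩
  ext1
  exact (congrArg NormedSpace.normalize (hGf a)).trans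
    (NormedSpace.normalize_eq_self_of_norm_eq_one (mem_sphere_zero_iff_norm.1 (f a).2))

end NormedSpace

theorem LipschitzExtendsAt.exists_normalize_extension {X V : Type*} [MetricSpace X]
    [NormedAddCommGroup V] [NormedSpace ℝ V] {C L m : ℝ≥0} {B : Set X} {F : X → V}
    (hE : LipschitzExtendsAt X (Metric.sphere (0 : V) 1) C (2 / m * L)) (hm : 0 < m)
    (hF : LipschitzOnWith L F B) (hFm : ∀ x ∈ B, m ≤ ‖F x‖) :
    ∃ g : X → V, LipschitzWith (C * (2 / m * L)) g ∧ (∀ x, ‖g x‖ = 1) ∧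
      ∀ x ∈ B, g x = NormedSpace.normalize (F x) := by
  have hsphere (x : B) : NormedSpace.normalize (F x) ∈ Metric.sphere (0 : V) 1 := by
    simpa using norm_pos_iff.1 ((NNReal.coe_pos.2 hm).trans_le (hFm x x.2))
  have hlip : LipschitzWith (2 / m * L) fun x : B => NormedSpace.normalize (F x) :=
    lipschitzOnWith_iff_restrict.1 ((lipschitzOnWith_normalize hm).comp hF hFm)
  obtain ⟨g, hg, hgf⟩ := hE B (fun x => ⟨_, hsphere x⟩) (hlip.subtype_mk hsphere)
  refine ⟨fun x => g x, ?_, fun x => mem_sphere_zero_iff_norm.1 (g x).2, fun x hx => ?_⟩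
  · simpa only [one_mul, Function.comp_def] using (LipschitzWith.subtype_val _).comp hg
  · exact congrArg Subtype.val (hgf ⟨x, hx⟩)

section ParityRounding

variable {ι : Type*} [Fintype ι]

theorem norm_le_sum_norm_apply (v : EuclideanSpace ℝ ι) : ‖v‖ ≤ ∑ i, ‖v i‖ := by
  conv_lhs => rw [← (EuclideanSpace.basisFun ι ℝ).sum_repr v]
  refine (norm_sum_le _ _).trans_eq (Finset.sum_congr rfl fun i _ => ?_)
  rw [norm_smul, OrthonormalBasis.norm_eq_one, mul_one, EuclideanSpace.basisFun_repr]

/-- The integer congruent to `b` modulo `2` that is nearest to `t`. -/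
noncomputable def roundInClass (b : ℤ) (t : ℝ) : ℤ :=
  2 * round ((t - b) / 2) + b

theorem abs_sub_roundInClass_le_one (b : ℤ) (t : ℝ) : |t - roundInClass b t| ≤ 1 := by
  have hround := abs_sub_round ((t - b) / 2)
  have hsplit : t - roundInClass b t = 2 * ((t - b) / 2 - round ((t - b) / 2)) := by
    simp only [roundInClass, Int.cast_add, Int.cast_mul, Int.cast_ofNat]
    ring
  rw [hsplit, abs_mul, abs_two]
  linarith

theorem intCast_roundInClass_zmod_two (b : ℤ) (t : ℝ) : (roundInClass b t : ZMod 2) = b := by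
  simp [roundInClass, show (2 : ZMod 2) = 0 from rfl]

variable [DecidableEq ι]

/-- An integer vector congruent to the `i`-th basis vector modulo `2` that approximates `v`. -/
noncomputable def roundToBasisClass (i : ι) (v : ι → ℝ) (j : ι) : ℤ :=
  roundInClass (if j = i then 1 else 0) (v j)

/-- Modulo `2` the matrix is the identity, so its determinant is odd. -/
theorem one_le_abs_det_roundToBasisClass (v : ι → ι → ℝ) :
    1 ≤ |(Matrix.of fun j i => (roundToBasisClass i (v i) j : ℝ)).det| := by
  let A : Matrix ι ι ℤ := .of fun j i => roundToBasisClass i (v i) j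
  have hmod : A.map (Int.castRingHom (ZMod 2)) = 1 := by
    ext j i
    simp [A, roundToBasisClass, intCast_roundInClass_zmod_two, Matrix.one_apply]
  have hdet : (A.det : ZMod 2) = 1 := by
    rw [← eq_intCast (Int.castRingHom (ZMod 2)), RingHom.map_det, RingHom.mapMatrix_apply, hmod,
      Matrix.det_one]
  have hA : A.det ≠ 0 := fun h => by simp [h] at hdet
  have hcast : (Matrix.of fun j i => (roundToBasisClass i (v i) j : ℝ)).det = A.det :=
    ((Int.castRingHom ℝ).map_det A).symm
  rw [hcast, ← Int.cast_abs]
  exact_mod_cast Int.one_le_abs hA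

theorem abs_adjugate_apply_le {A : Matrix ι ι ℝ} {M : ℝ} (hM₁ : 1 ≤ M)
    (hM : ∀ i j, |A i j| ≤ M) (i j : ι) :
    |A.adjugate i j| ≤ (Fintype.card ι).factorial * M ^ Fintype.card ι := by
  have hentry (p q : ι) : |A.updateRow j (Pi.single i 1) p q| ≤ M := by
    rw [Matrix.updateRow_apply, Pi.single_apply]
    split_ifs
    · simpa using hM₁
    · simpa using zero_le_one.trans hM₁
    · exact hM p q
  rw [Matrix.adjugate_apply, ← nsmul_eq_mul]
  exact Matrix.det_le (abv := (AbsoluteValue.abs : AbsoluteValue ℝ ℝ)) hentry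

theorem abs_apply_le_of_one_le_abs_det {A : Matrix ι ι ℝ} {M b : ℝ} {a : ι → ℝ}
    (hdet : 1 ≤ |A.det|) (hM₁ : 1 ≤ M) (hM : ∀ i j, |A i j| ≤ M)
    (hb : ∀ j, |A.mulVec a j| ≤ b) (k : ι) :
    |a k| ≤ Fintype.card ι * ((Fintype.card ι).factorial * M ^ Fintype.card ι * b) := by
  have hcramer : A.det * a k = ∑ j, A.adjugate k j * A.mulVec a j := by
    have : A.adjugate.mulVec (A.mulVec a) = A.det • a := by
      rw [Matrix.mulVec_mulVec, Matrix.adjugate_mul, Matrix.smul_mulVec, Matrix.one_mulVec]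
    exact (congrFun this k).symm
  calc |a k| ≤ |A.det| * |a k| := le_mul_of_one_le_left (abs_nonneg _) hdet
    _ = |∑ j, A.adjugate k j * A.mulVec a j| := by rw [← abs_mul, hcramer]
    _ ≤ ∑ j, |A.adjugate k j| * |A.mulVec a j| := by
      simpa only [abs_mul] using
        Finset.abs_sum_le_sum_abs (fun j => A.adjugate k j * A.mulVec a j) Finset.univ
    _ ≤ ∑ _j : ι, (Fintype.card ι).factorial * M ^ Fintype.card ι * b := by
      gcongr with j
      · exact abs_adjugate_apply_le hM₁ hM k j
      · exact hb j
    _ = _ := by simp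

/-- The lattice point of `(1 / N) ℤ ^ ι` near `v` whose multiple by `N` is congruent modulo `2` to
the `i`-th basis vector. Choosing one such point for each `i` always gives a basis. -/
noncomputable def parityRound (N : ℝ) (i : ι) (v : EuclideanSpace ℝ ι) : EuclideanSpace ℝ ι :=
  WithLp.toLp 2 fun j => N⁻¹ * roundToBasisClass i (N • v.ofLp) j

theorem norm_sub_parityRound_le {N : ℝ} (hN : 0 < N) (i : ι) (v : EuclideanSpace ℝ ι) :
    ‖v - parityRound N i v‖ ≤ Fintype.card ι / N := by
  have hcoord (j : ι) : ‖(v - parityRound N i v) j‖ ≤ N⁻¹ := by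
    have hsplit : (v - parityRound N i v) j
        = N⁻¹ * (N * v j - roundToBasisClass i (N • v.ofLp) j) := by
      simp only [parityRound, PiLp.sub_apply]
      field_simp
    rw [hsplit, norm_mul, norm_inv, Real.norm_of_nonneg hN.le]
    exact mul_le_of_le_one_right (inv_nonneg.2 hN.le) (abs_sub_roundInClass_le_one _ _)
  calc ‖v - parityRound N i v‖ ≤ ∑ j, ‖(v - parityRound N i v) j‖ := norm_le_sum_norm_apply _
    _ ≤ ∑ _j : ι, N⁻¹ := Finset.sum_le_sum fun j _ => hcoord j
    _ = Fintype.card ι / N := by simp [div_eq_mul_inv]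

theorem exists_mul_sum_le_norm_sum_smul_parityRound {N : ℝ} (hN : 0 < N) :
    ∃ δ : ℝ, 0 < δ ∧ ∀ (v : ι → EuclideanSpace ℝ ι) (a : ι → ℝ), (∀ i, ‖v i‖ ≤ 1) →
      δ * ∑ i, |a i| ≤ ‖∑ i, a i • parityRound N i (v i)‖ := by
  set d : ℝ := (Fintype.card ι : ℝ)
  set c : ℝ := d * (d * ((Fintype.card ι).factorial * (N + 1) ^ Fintype.card ι * N))
  have hc : 0 < c + 1 := by positivity
  refine ⟨(c + 1)⁻¹, inv_pos.2 hc, fun v a hv => ?_⟩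
  let A : Matrix ι ι ℝ := .of fun j i => (roundToBasisClass i (N • (v i).ofLp) j : ℝ)
  set w := ∑ i, a i • parityRound N i (v i)
  have hdet : 1 ≤ |A.det| := one_le_abs_det_roundToBasisClass fun i => N • (v i).ofLp
  have hentry (j i : ι) : |A j i| ≤ N + 1 := by
    have hv' : |N * v i j| ≤ N := by
      rw [abs_mul, abs_of_pos hN]
      exact mul_le_of_le_one_right hN.le ((PiLp.norm_apply_le (v i) j).trans (hv i))
    have hround : |N * v i j - A j i| ≤ 1 := abs_sub_roundInClass_le_one _ _
    rw [abs_le] at *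
    constructor <;> linarith
  have hmulVec (j : ι) : |A.mulVec a j| ≤ N * ‖w‖ := by
    have : A.mulVec a j = N * w j := by
      simp only [w, A, Matrix.mulVec, dotProduct, parityRound, Matrix.of_apply,
        WithLp.ofLp_sum, Finset.sum_apply, PiLp.smul_apply, smul_eq_mul, Finset.mul_sum]
      exact Finset.sum_congr rfl fun i _ => by field_simp
    rw [this, abs_mul, abs_of_pos hN]
    gcongr
    exact PiLp.norm_apply_le w j
  rw [inv_mul_le_iff₀ hc]
  calc ∑ i, |a i|
      ≤ ∑ _i : ι, d * ((Fintype.card ι).factorial * (N + 1) ^ Fintype.card ι * (N * ‖w‖)) := by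
        gcongr with i
        exact abs_apply_le_of_one_le_abs_det hdet (by linarith) hentry hmulVec i
    _ = c * ‖w‖ := by simp only [Finset.sum_const, Finset.card_univ, nsmul_eq_mul, c, d]; ring
    _ ≤ (c + 1) * ‖w‖ := by gcongr; linarith

end ParityRounding

section LocalBump

/-- A Lipschitz bump attached to one colour of a cover: the clusters of points of positive weight
are `s`-separated, and `center` picks a point near each cluster. -/
structure LocalBump (X : Type*) [MetricSpace X] (s D : ℝ≥0) where
  weight : X → ℝ
  center : X → X
  weight_nonneg : ∀ x, 0 ≤ weight x
  weight_le_one : ∀ x, weight x ≤ 1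
  lipschitz_weight : LipschitzWith s⁻¹ weight
  dist_center_le : ∀ ⦃x⦄, 0 < weight x → dist x (center x) ≤ D
  center_eq : ∀ ⦃x y⦄, 0 < weight x → 0 < weight y → dist x y < s → center x = center y

variable {X : Type*} [MetricSpace X]

theorem lipschitzWith_coe_thickenedIndicator {s : ℝ≥0} (hs : 0 < (s : ℝ)) (A : Set X) :
    LipschitzWith s⁻¹ fun x => (thickenedIndicator hs A x : ℝ) := by
  simpa only [one_mul, Real.toNNReal_coe, Function.comp_def] using
    NNReal.isometry_coe.lipschitz.comp (lipschitzWith_thickenedIndicator hs A)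

/-- The union of the members of a family that come closer than `s` to the point `x`. -/
def nearbyUnion (𝒰 : Set (Set X)) (s : ℝ) (x : X) : Set X :=
  ⋃₀ {U ∈ 𝒰 | x ∈ Metric.thickening s U}

theorem nearbyUnion_nonempty {𝒰 : Set (Set X)} {s : ℝ} {x : X}
    (hx : x ∈ Metric.thickening s (⋃₀ 𝒰)) : (nearbyUnion 𝒰 s x).Nonempty := by
  obtain ⟨z, ⟨U, hU, hzU⟩, hxz⟩ := Metric.mem_thickening_iff.1 hx
  exact ⟨z, U, ⟨hU, Metric.mem_thickening_iff.2 ⟨z, hzU, hxz⟩⟩, hzU⟩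

theorem dist_le_of_mem_nearbyUnion {𝒰 : Set (Set X)} {s D : ℝ} {x p : X}
    (hD : ∀ U ∈ 𝒰, ∀ x ∈ U, ∀ y ∈ U, dist x y ≤ D) (hp : p ∈ nearbyUnion 𝒰 s x) :
    dist x p ≤ D + s := by
  obtain ⟨U, ⟨hU, hxU⟩, hpU⟩ := hp
  obtain ⟨z, hzU, hxz⟩ := Metric.mem_thickening_iff.1 hxU
  linarith [dist_triangle x z p, hD U hU z hzU p hpU]

theorem IsRDisjointFamily.nearbyUnion_subset {𝒰 : Set (Set X)} {s : ℝ} {x y : X}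
    (h𝒰 : IsRDisjointFamily (3 * s) 𝒰) (hy : (nearbyUnion 𝒰 s y).Nonempty)
    (hxy : dist x y < s) : nearbyUnion 𝒰 s x ⊆ nearbyUnion 𝒰 s y := by
  obtain ⟨-, V, ⟨hV, hyV⟩, -⟩ := hy
  rintro p ⟨U, ⟨hU, hxU⟩, hpU⟩
  obtain ⟨z, hzU, hxz⟩ := Metric.mem_thickening_iff.1 hxU
  obtain ⟨w, hwV, hyw⟩ := Metric.mem_thickening_iff.1 hyV
  have hzw : dist z w < 3 * s := by
    linarith [dist_triangle4 z x y w, dist_comm x z]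
  have hUV : U = V := by_contra fun hne => (h𝒰 U hU V hV hne z hzU w hwV).not_gt hzw
  exact ⟨V, ⟨hV, hyV⟩, hUV ▸ hpU⟩

open scoped Classical in
/-- The bump equal to `1` on an `r`-disjoint family with `r = 3 * s` and supported in its
`s`-neighbourhood. -/
noncomputable def LocalBump.ofFamily {s D : ℝ≥0} (hs : 0 < (s : ℝ)) {𝒰 : Set (Set X)}
    (h𝒰 : IsRDisjointFamily (3 * s) 𝒰) (hD : ∀ U ∈ 𝒰, ∀ x ∈ U, ∀ y ∈ U, dist x y ≤ D) :
    LocalBump X s (D + s) :=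
  have hnear {x : X} (hx : 0 < (thickenedIndicator hs (⋃₀ 𝒰) x : ℝ)) :
      (nearbyUnion 𝒰 s x).Nonempty :=
    nearbyUnion_nonempty <| by_contra fun h => by
      rw [thickenedIndicator_zero hs _ h] at hx
      exact hx.false
  { weight x := thickenedIndicator hs (⋃₀ 𝒰) x
    center x := if h : (nearbyUnion 𝒰 s x).Nonempty then h.some else x
    weight_nonneg _ := NNReal.coe_nonneg _
    weight_le_one x := NNReal.coe_le_one.2 (thickenedIndicator_le_one hs _ x)
    lipschitz_weight := lipschitzWith_coe_thickenedIndicator hs _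
    dist_center_le x hx := by
      rw [dif_pos (hnear hx)]
      exact_mod_cast dist_le_of_mem_nearbyUnion hD (hnear hx).some_mem
    center_eq x y hx hy hxy := by
      have heq : nearbyUnion 𝒰 s x = nearbyUnion 𝒰 s y :=
        (h𝒰.nearbyUnion_subset (hnear hy) hxy).antisymm
          (h𝒰.nearbyUnion_subset (hnear hx) (dist_comm x y ▸ hxy))
      simp only [dif_pos (hnear hy), heq] }

theorem HasColoredCover.exists_localBump {n : ℕ} {s D : ℝ≥0} (hs : 0 < s)
    (h : HasColoredCover X n (3 * s) D) :
    ∃ b : Fin (n + 1) → LocalBump X s (D + s), ∀ x, ∃ i, (b i).weight x = 1 := by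
  obtain ⟨𝒰, hcover, hdisj, hdiam⟩ := h
  refine ⟨fun i => .ofFamily (NNReal.coe_pos.2 hs) (hdisj i) (hdiam i), fun x => ?_⟩
  obtain ⟨i, U, hU, hxU⟩ := hcover x
  have hx : x ∈ ⋃₀ 𝒰 i := ⟨U, hU, hxU⟩
  exact ⟨i, congrArg NNReal.toReal (thickenedIndicator_one hs _ hx)⟩

end LocalBump

namespace LocalBump

variable {X V ι : Type*} [MetricSpace X] [NormedAddCommGroup V] [NormedSpace ℝ V]
  {s D B : ℝ≥0}

theorem norm_weight_smul (b : LocalBump X s D) (x : X) (v : V) :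
    ‖b.weight x • v‖ = b.weight x * ‖v‖ := by
  rw [norm_smul, Real.norm_of_nonneg (b.weight_nonneg x)]

theorem abs_weight_sub_le (b : LocalBump X s D) (x y : X) :
    |b.weight x - b.weight y| ≤ (s : ℝ)⁻¹ * dist x y := by
  simpa only [Real.dist_eq, NNReal.coe_inv] using b.lipschitz_weight.dist_le_mul x y

/-- The map `t ∘ b.center` is discontinuous only where the weight vanishes or across a gap of
width `s` between two clusters. -/
theorem lipschitzWith_weight_smul_center (hs : 0 < s) (b : LocalBump X s D) {t : X → V}
    (ht : ∀ x, ‖t x‖ ≤ B) :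
    LipschitzWith (2 * B * s⁻¹) fun x => b.weight x • t (b.center x) := by
  refine LipschitzWith.of_dist_le_mul fun x y => ?_
  have hs' : (0 : ℝ) < s := hs
  have hbound (z : X) : ‖b.weight z • t (b.center z)‖ ≤ b.weight z * B := by
    rw [norm_weight_smul]
    exact mul_le_mul_of_nonneg_left (ht _) (b.weight_nonneg z)
  have hB : |b.weight x - b.weight y| * B ≤ 2 * B * ((s : ℝ)⁻¹ * dist x y) := by
    rw [mul_comm, mul_assoc]
    have h := mul_le_mul_of_nonneg_left (b.abs_weight_sub_le x y) B.coe_nonneg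
    exact h.trans (le_mul_of_one_le_left ((by positivity : (0 : ℝ) ≤ _).trans h) one_le_two)
  push_cast
  rw [dist_eq_norm, mul_assoc (2 * (B : ℝ))]
  rcases (b.weight_nonneg x).eq_or_lt with hx | hx
  · rw [← hx] at hB ⊢
    rw [zero_smul, zero_sub, norm_neg]
    rw [zero_sub, abs_neg, abs_of_nonneg (b.weight_nonneg y)] at hB
    exact (hbound y).trans hB
  rcases (b.weight_nonneg y).eq_or_lt with hy | hy
  · rw [← hy] at hB ⊢
    rw [zero_smul, sub_zero]
    rw [sub_zero, abs_of_nonneg (b.weight_nonneg x)] at hB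
    exact (hbound x).trans hB
  rcases lt_or_ge (dist x y) s with hxy | hxy
  · rw [b.center_eq hx hy hxy, ← sub_smul, norm_smul]
    exact (mul_le_mul_of_nonneg_left (ht _) (norm_nonneg _)).trans hB
  · have hle : 1 ≤ (s : ℝ)⁻¹ * dist x y := (one_le_inv_mul₀ hs').2 hxy
    have hone (z : X) : b.weight z * B ≤ B :=
      mul_le_of_le_one_left B.coe_nonneg (b.weight_le_one z)
    calc _ ≤ ‖b.weight x • t (b.center x)‖ + ‖b.weight y • t (b.center y)‖ := norm_sub_le _ _
      _ ≤ B + B := add_le_add ((hbound x).trans (hone x)) ((hbound y).trans (hone y))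
      _ = 2 * B * 1 := by ring
      _ ≤ 2 * B * ((s : ℝ)⁻¹ * dist x y) := by gcongr

variable [Fintype ι]

/-- The average, with the weights of the bumps `b i`, of the values of `t i` at the centers. It
turns the arbitrary maps `t i` into a Lipschitz map. -/
noncomputable def blend (b : ι → LocalBump X s D) (t : ι → X → V) (x : X) : V :=
  Finset.univ.centerMass (fun i => (b i).weight x) fun i => t i ((b i).center x)

variable {b : ι → LocalBump X s D} {t : ι → X → V}

theorem one_le_sum_weight {x : X} (hx : ∃ i, (b i).weight x = 1) :
    1 ≤ ∑ i, (b i).weight x := by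
  obtain ⟨i, hi⟩ := hx
  exact hi.ge.trans
    (Finset.single_le_sum (fun j _ => (b j).weight_nonneg x) (Finset.mem_univ i))

theorem lipschitzWith_blend (hs : 0 < s) (hb : ∀ x, ∃ i, (b i).weight x = 1)
    (ht : ∀ i x, ‖t i x‖ ≤ B) :
    LipschitzWith (3 * (Fintype.card ι * (B * s⁻¹))) (blend b t) := by
  have hnum : LipschitzWith (∑ _i : ι, 2 * B * s⁻¹)
      fun x => ∑ i, (b i).weight x • t i ((b i).center x) :=
    lipschitzWith_sum fun i _ => (b i).lipschitzWith_weight_smul_center hs (ht i)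
  have hden : LipschitzWith (∑ _i : ι, s⁻¹) fun x => ∑ i, (b i).weight x :=
    lipschitzWith_sum fun i _ => (b i).lipschitz_weight
  have hle (x : X) : ‖∑ i, (b i).weight x • t i ((b i).center x)‖
      ≤ B * ∑ i, (b i).weight x := by
    rw [Finset.mul_sum]
    refine norm_sum_le_of_le _ fun i _ => ?_
    rw [norm_weight_smul, mul_comm]
    exact mul_le_mul_of_nonneg_right (ht i _) ((b i).weight_nonneg x)
  refine LipschitzWith.of_dist_le_mul fun x y => ?_
  have hsub := norm_inv_smul_sub_inv_smul_le one_pos (one_le_sum_weight (hb x))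
    (one_le_sum_weight (hb y)) (v := ∑ i, (b i).weight x • t i ((b i).center x)) (hle y)
  have hnum' := hnum.dist_le_mul x y
  have hden' := mul_le_mul_of_nonneg_left (hden.dist_le_mul x y) B.coe_nonneg
  rw [dist_eq_norm] at hnum' ⊢
  rw [Real.dist_eq] at hden'
  simp only [Finset.sum_const, Finset.card_univ, nsmul_eq_mul] at hnum' hden'
  refine hsub.trans ?_
  push_cast at hnum' hden' ⊢
  linarith

theorem norm_blend_sub_le {x : X} {v : V} {ε : ℝ} (hx : ∃ i, (b i).weight x = 1)
    (hε : ∀ i, 0 < (b i).weight x → ‖t i ((b i).center x) - v‖ ≤ ε) :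
    ‖blend b t x - v‖ ≤ ε := by
  classical
  rw [← mem_closedBall_iff_norm, blend, ← Finset.centerMass_filter_ne_zero]
  refine (convex_closedBall v ε).centerMass_mem (fun i _ => (b i).weight_nonneg x) ?_
    fun i hi => mem_closedBall_iff_norm.2
      (hε i (((b i).weight_nonneg x).lt_of_ne' (Finset.mem_filter.1 hi).2))
  rw [Finset.sum_filter_ne_zero]
  exact one_pos.trans_le (one_le_sum_weight hx)

theorem le_norm_blend {x : X} {δ : ℝ} (hx : ∃ i, (b i).weight x = 1)
    (hδ : ∀ a : ι → ℝ, δ * ∑ i, |a i| ≤ ‖∑ i, a i • t i ((b i).center x)‖) :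
    δ ≤ ‖blend b t x‖ := by
  have hpos := one_pos.trans_le (one_le_sum_weight hx)
  have h := hδ fun i => (b i).weight x
  simp only [abs_of_nonneg ((b _).weight_nonneg x)] at h
  rwa [blend, Finset.centerMass, norm_smul, norm_inv, Real.norm_of_nonneg hpos.le,
    le_inv_mul_iff₀ hpos, mul_comm]

end LocalBump

section CoverToExtension

variable {X : Type*} [MetricSpace X]

/-- Away from the `s`-neighbourhood of `A` the glued map is `g`; inside it `F` has norm at least
`7 / 8` and the glued map is within `1 / 4` of it. -/
theorem exists_lipschitzWith_eqOn_le_norm {V : Type*} [NormedAddCommGroup V] [NormedSpace ℝ V]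
    {s KF Kg : ℝ≥0} {δ : ℝ} {A : Set X} {F g : X → V} (hs : 0 < s) (hKs : 8 * KF * s ≤ 1)
    (hF : LipschitzWith KF F) (hg : LipschitzWith Kg g) (hFA : ∀ a ∈ A, ‖F a‖ = 1)
    (hFg : ∀ x, ‖g x - F x‖ ≤ 1 / 4) (hδ : ∀ x, δ ≤ ‖g x‖) :
    ∃ G : X → V, LipschitzWith (2 * Kg + KF + s⁻¹) G ∧ (∀ x, min δ (1 / 2) ≤ ‖G x‖) ∧
      EqOn G F A := by
  have hs' : (0 : ℝ) < s := hs
  let χ : X → ℝ := fun x => thickenedIndicator hs' A x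
  have hχ₀ (x : X) : 0 ≤ χ x := NNReal.coe_nonneg _
  have hχ₁ (x : X) : χ x ≤ 1 := NNReal.coe_le_one.2 (thickenedIndicator_le_one hs' A x)
  have hFg' (x : X) : ‖F x - g x‖ ≤ (1 : ℝ≥0) := by
    rw [norm_sub_rev, NNReal.coe_one]
    exact (hFg x).trans (by norm_num)
  refine ⟨fun x => AffineMap.lineMap (g x) (F x) (χ x), ?_, fun x => ?_, fun a ha => ?_⟩
  · refine (lipschitzWith_lineMap_of_norm_sub_le (lipschitzWith_coe_thickenedIndicator hs' A) hg hF
      (fun x => ?_) hFg').weaken (by rw [mul_one])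
    exact (Real.norm_of_nonneg (hχ₀ x)).trans_le (hχ₁ x)
  · by_cases hx : x ∈ Metric.thickening s A
    · obtain ⟨a, ha, hxa⟩ := Metric.mem_thickening_iff.1 hx
      have hFx : ‖F a - F x‖ ≤ 1 / 8 := by
        rw [← dist_eq_norm, dist_comm]
        have := (hF.dist_le_mul x a).trans (mul_le_mul_of_nonneg_left hxa.le KF.coe_nonneg)
        have : (8 * KF * s : ℝ) ≤ 1 := mod_cast hKs
        linarith
      have hGF : ‖F x - AffineMap.lineMap (g x) (F x) (χ x)‖ ≤ 1 / 4 := by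
        rw [← dist_eq_norm, dist_comm, dist_lineMap_right, dist_eq_norm,
          Real.norm_of_nonneg (sub_nonneg.2 (hχ₁ x))]
        exact (mul_le_of_le_one_left (norm_nonneg _) (by linarith [hχ₀ x])).trans (hFg x)
      refine (min_le_right _ _).trans ?_
      linarith [hFA a ha, norm_sub_norm_le (F a) (F x),
        norm_sub_norm_le (F x) (AffineMap.lineMap (g x) (F x) (χ x))]
    · have hχx : χ x = 0 := by simp only [χ, thickenedIndicator_zero hs' A hx, NNReal.coe_zero]
      simpa only [hχx, AffineMap.lineMap_apply_zero] using (min_le_left _ _).trans (hδ x)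
  · have hχa : χ a = 1 := by simp only [χ, thickenedIndicator_one hs' A ha, NNReal.coe_one]
    simp only [hχa, AffineMap.lineMap_apply_one]

/-- At each point `g` is an average of lattice points of different parities near the values of `F`,
so it is close to `F` but stays away from `0`. -/
theorem exists_lipschitzWith_le_norm_of_localBump (ι : Type*) [Fintype ι] :
    ∃ δ : ℝ, 0 < δ ∧ ∀ (s D KF : ℝ≥0) (b : ι → LocalBump X s D) (F : X → EuclideanSpace ℝ ι),
      0 < s → 8 * KF * D ≤ 1 → (∀ x, ∃ i, (b i).weight x = 1) → LipschitzWith KF F →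
      (∀ x, ‖F x‖ ≤ 1) → ∃ g : X → EuclideanSpace ℝ ι,
        LipschitzWith (6 * Fintype.card ι * s⁻¹) g ∧ (∀ x, ‖g x - F x‖ ≤ 1 / 4) ∧
        ∀ x, δ ≤ ‖g x‖ := by
  classical
  set N : ℝ := 8 * (Fintype.card ι + 1)
  have hN : 0 < N := by positivity
  obtain ⟨δ, hδ, hlower⟩ := exists_mul_sum_le_norm_sum_smul_parityRound (ι := ι) hN
  refine ⟨δ, hδ, fun s D KF b F hs hKD hb hF hF₁ => ?_⟩
  have hround (i : ι) (v : EuclideanSpace ℝ ι) : ‖parityRound N i v - v‖ ≤ 1 / 8 := by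
    rw [norm_sub_rev]
    refine (norm_sub_parityRound_le hN i v).trans ?_
    rw [div_le_iff₀ hN]
    linarith
  have hbound (i : ι) (x : X) : ‖parityRound N i (F x)‖ ≤ (2 : ℝ≥0) := by
    rw [NNReal.coe_ofNat]
    linarith [hround i (F x), hF₁ x, norm_le_norm_add_norm_sub' (parityRound N i (F x)) (F x)]
  refine ⟨LocalBump.blend b fun i x => parityRound N i (F x),
    (LocalBump.lipschitzWith_blend hs hb hbound).weaken (le_of_eq (by ring)),
    fun x => LocalBump.norm_blend_sub_le (hb x) fun i hi => ?_,
    fun x => LocalBump.le_norm_blend (hb x) fun a => hlower _ a fun i => hF₁ _⟩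
  have hcenter : ‖F ((b i).center x) - F x‖ ≤ 1 / 8 := by
    rw [← dist_eq_norm, dist_comm]
    have := (hF.dist_le_mul x _).trans
      (mul_le_mul_of_nonneg_left ((b i).dist_center_le hi) KF.coe_nonneg)
    have : (8 * KF * D : ℝ) ≤ 1 := mod_cast hKD
    linarith
  linarith [hround i (F ((b i).center x)),
    norm_sub_le_norm_sub_add_norm_sub (parityRound N i (F ((b i).center x)))
      (F ((b i).center x)) (F x)]

theorem exists_lipschitzExtendsAt_sphere_of_localBump (ι : Type*) [Fintype ι] (κ : ℝ≥0) :
    ∃ C : ℝ≥0, 0 < C ∧ ∀ (l s D : ℝ≥0) (b : ι → LocalBump X s D), 0 < s → s ≤ D → s⁻¹ ≤ κ * l →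
      8 * (2 * lipschitzExtensionConstant (EuclideanSpace ℝ ι) * l) * D ≤ 1 →
      (∀ x, ∃ i, (b i).weight x = 1) →
      LipschitzExtendsAt X (Metric.sphere (0 : EuclideanSpace ℝ ι) 1) C l := by
  set K : ℝ≥0 := 2 * lipschitzExtensionConstant (EuclideanSpace ℝ ι)
  set d : ℝ≥0 := (Fintype.card ι : ℝ≥0)
  obtain ⟨δ, hδ, happrox⟩ := exists_lipschitzWith_le_norm_of_localBump (X := X) ι
  set m : ℝ≥0 := min δ.toNNReal (1 / 2)
  have hm : 0 < m := lt_min (Real.toNNReal_pos.2 hδ) (by norm_num)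
  have hm' : (m : ℝ) = min δ (1 / 2) := by simp [m, hδ.le]
  refine ⟨2 / m * (2 * (6 * d * κ) + K + κ) + 1, by positivity, ?_⟩
  intro l s D b hs hsD hsl hKD hb A f hf
  obtain ⟨F, hF, hF₁, hFf⟩ := exists_lipschitzWith_extension_norm_le_one hf
  obtain ⟨g, hg, hFg, hgδ⟩ := happrox s D _ b F hs hKD hb hF hF₁
  have hFA (a : X) (ha : a ∈ A) : ‖F a‖ = 1 := by
    simpa using congrArg norm (hFf ⟨a, ha⟩)
  have hKs : 8 * (K * l) * s ≤ 1 := (mul_le_mul_right hsD _).trans hKD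
  obtain ⟨G, hG, hGm, hGF⟩ := exists_lipschitzWith_eqOn_le_norm hs hKs hF hg hFA hFg hgδ
  obtain ⟨h, hh, hhf⟩ := exists_sphere_extension_of_le_norm hm hG (fun x => hm'.trans_le (hGm x))
    fun a => (hGF a.2).trans (hFf a)
  refine ⟨h, hh.weaken ?_, hhf⟩
  calc 2 / m * (2 * (6 * d * s⁻¹) + K * l + s⁻¹)
      ≤ 2 / m * (2 * (6 * d * (κ * l)) + K * l + κ * l) := by gcongr
    _ = 2 / m * (2 * (6 * d * κ) + K + κ) * l := by ring
    _ ≤ _ := by gcongr; exact le_self_add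

end CoverToExtension

section Suspension

variable {X : Type*} [MetricSpace X]

theorem LipschitzExtendsAt.congr_isometryEquiv {E E' : Type*} [MetricSpace E] [MetricSpace E']
    {C l : ℝ≥0} (h : LipschitzExtendsAt X E C l) (e : E ≃ᵢ E') : LipschitzExtendsAt X E' C l := by
  intro A f hf
  obtain ⟨g, hg, hgf⟩ := h A (e.symm ∘ f) (by simpa using e.symm.isometry.lipschitz.comp hf)
  refine ⟨e ∘ g, by simpa using e.isometry.lipschitz.comp hg, fun a => ?_⟩
  rw [Function.comp_apply, hgf, Function.comp_apply, e.apply_symm_apply]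

theorem LipschitzExtendsAt.sphere_congr_finrank {V W : Type*} [NormedAddCommGroup V]
    [InnerProductSpace ℝ V] [FiniteDimensional ℝ V] [NormedAddCommGroup W]
    [InnerProductSpace ℝ W] [FiniteDimensional ℝ W] {C l : ℝ≥0}
    (h : LipschitzExtendsAt X (Metric.sphere (0 : V) 1) C l)
    (hrank : Module.finrank ℝ V = Module.finrank ℝ W) :
    LipschitzExtendsAt X (Metric.sphere (0 : W) 1) C l := by
  let e : V ≃ₗᵢ[ℝ] W := (stdOrthonormalBasis ℝ V).equiv (stdOrthonormalBasis ℝ W) (finCongr hrank)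
  exact h.congr_isometryEquiv
    ⟨e.toEquiv.subtypeEquiv fun v => by simp, fun v w => e.isometry v w⟩

theorem half_le_norm_fst_of_norm_eq_one {V : Type*} [SeminormedAddCommGroup V]
    {v : WithLp 2 (V × ℝ)} (hv : ‖v‖ = 1)
    (hsnd : |v.snd| ≤ 1 / 2) : 1 / 2 ≤ ‖v.fst‖ := by
  have hsq := WithLp.prod_norm_sq_eq_of_L2 v
  rw [hv, Real.norm_eq_abs] at hsq
  by_contra! hlt
  nlinarith [norm_nonneg v.fst, abs_nonneg v.snd]

theorem lipschitzWith_toLp_prod {V : Type*} [NormedAddCommGroup V] {K Kh : ℝ≥0} {h : X → V}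
    {T : X → ℝ} (hh : LipschitzWith Kh h) (hT : LipschitzWith K T) :
    LipschitzWith (Kh + K) fun x => WithLp.toLp 2 (h x, T x) := by
  refine LipschitzWith.of_dist_le_mul fun x y => ?_
  calc dist (WithLp.toLp 2 (h x, T x)) (WithLp.toLp 2 (h y, T y))
      ≤ dist (h x) (h y) + dist (T x) (T y) := by
        rw [WithLp.prod_dist_eq_of_L2]
        exact Real.sqrt_le_iff.2 ⟨by positivity, pow_add_pow_le dist_nonneg dist_nonneg two_ne_zero⟩
    _ ≤ Kh * dist x y + K * dist x y := add_le_add (hh.dist_le_mul x y) (hT.dist_le_mul x y)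
    _ = (Kh + K : ℝ≥0) * dist x y := by push_cast; ring

section NormedSpace

variable {V : Type*} [NormedAddCommGroup V] [NormedSpace ℝ V] {K Kg : ℝ≥0} {u g : X → V}

theorem lipschitzWith_max_norm_smul (hu : LipschitzWith K u) (hg : LipschitzWith Kg g)
    (hu₁ : ∀ x, ‖u x‖ ≤ 1) (hg₁ : ∀ x, ‖g x‖ ≤ 1) {c : ℝ} (hc₀ : 0 ≤ c) (hc : c ≤ 1) :
    LipschitzWith (K + Kg) fun x => max ‖u x‖ c • g x := by
  have hmax : LipschitzWith K fun x => max ‖u x‖ c := by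
    simpa only [one_mul, Function.comp_def] using (lipschitzWith_one_norm.comp hu).max_const c
  refine (lipschitzWith_smul_of_norm_le (a := 1) (b := 1) hmax hg (fun x => ?_)
    (by simpa using hg₁)).weaken (by rw [one_mul, mul_one, add_comm])
  rw [Real.norm_of_nonneg (le_max_of_le_right hc₀)]
  exact max_le (hu₁ x) hc

theorem exists_cutoff {T : X → ℝ} (hT : LipschitzWith K T) :
    ∃ χ : X → ℝ, LipschitzWith (4 * K) χ ∧ (∀ x, χ x ∈ Icc 0 1) ∧
      (∀ x, |T x| ≤ 1 / 4 → χ x = 0) ∧ ∀ x, 1 / 2 ≤ |T x| → χ x = 1 := by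
  have hlip : LipschitzWith (4 * K) fun x => 4 * |T x| - 1 := by
    refine LipschitzWith.of_dist_le_mul fun x y => ?_
    have habs := (abs_abs_sub_abs_le (T x) (T y)).trans (hT.dist_le_mul x y)
    rw [Real.dist_eq, sub_sub_sub_cancel_right, ← mul_sub, abs_mul, abs_of_pos four_pos]
    push_cast
    linarith
  refine ⟨fun x => projIcc 0 1 zero_le_one (4 * |T x| - 1), ?_, fun x => Subtype.coe_prop _,
    fun x hx => ?_, fun x hx => ?_⟩
  · simpa only [one_mul, Function.comp_def] using
      (LipschitzWith.subtype_val _).comp ((LipschitzWith.projIcc zero_le_one).comp hlip)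
  · have hle : 4 * |T x| - 1 ≤ 0 := by linarith
    simp only [projIcc_of_le_left zero_le_one hle]
  · have hle : 1 ≤ 4 * |T x| - 1 := by linarith
    simp only [projIcc_of_right_le zero_le_one hle]

/-- The map interpolates, according to `|T|`, between `max ‖u‖ (1 / 2) • g` and `u`. -/
theorem exists_lipschitzWith_interpolation {T : X → ℝ} (hu : LipschitzWith K u)
    (hT : LipschitzWith K T) (hg : LipschitzWith Kg g) (hu₁ : ∀ x, ‖u x‖ ≤ 1)
    (hg₁ : ∀ x, ‖g x‖ = 1) :
    ∃ h : X → V, LipschitzWith (11 * K + 2 * Kg) h ∧ (∀ x, |T x| ≤ 1 / 4 → 1 / 2 ≤ ‖h x‖) ∧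
      (∀ x, 1 / 2 ≤ |T x| → h x = u x) ∧
      ∀ x, 1 / 2 ≤ ‖u x‖ → g x = NormedSpace.normalize (u x) → h x = u x := by
  obtain ⟨χ, hχ, hχ₀₁, hχ₀, hχ₁⟩ := exists_cutoff hT
  have hscaled : LipschitzWith (K + Kg) fun x => max ‖u x‖ (1 / 2) • g x :=
    lipschitzWith_max_norm_smul hu hg hu₁ (fun x => (hg₁ x).le) (by norm_num) (by norm_num)
  have hnorm (x : X) : ‖max ‖u x‖ (1 / 2) • g x‖ = max ‖u x‖ (1 / 2) := by
    rw [norm_smul, hg₁, mul_one, Real.norm_of_nonneg (le_max_of_le_left (norm_nonneg _))]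
  have hdiff (x : X) : ‖u x - max ‖u x‖ (1 / 2) • g x‖ ≤ (2 : ℝ≥0) := by
    have hmax : max ‖u x‖ (1 / 2) ≤ 1 := max_le (hu₁ x) (by norm_num)
    rw [NNReal.coe_ofNat]
    linarith [norm_sub_le (u x) (max ‖u x‖ (1 / 2) • g x), hnorm x, hu₁ x]
  refine ⟨fun x => AffineMap.lineMap (max ‖u x‖ (1 / 2) • g x) (u x) (χ x), ?_, fun x hx => ?_,
    fun x hx => ?_, fun x hux hgx => ?_⟩
  · refine (lipschitzWith_lineMap_of_norm_sub_le hχ hscaled hu (fun x => ?_) hdiff).weaken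
      (le_of_eq (by ring))
    rw [Real.norm_of_nonneg (hχ₀₁ x).1]
    exact (hχ₀₁ x).2
  · simp only [hχ₀ x hx, AffineMap.lineMap_apply_zero, hnorm, le_max_right]
  · simp only [hχ₁ x hx, AffineMap.lineMap_apply_one]
  · simp only [max_eq_left hux, hgx, NormedSpace.norm_smul_normalize, AffineMap.lineMap_same_apply]

theorem exists_lipschitzWith_le_norm_of_suspension {F : X → WithLp 2 (V × ℝ)}
    (hF : LipschitzWith K F) (hF₁ : ∀ x, ‖F x‖ ≤ 1) (hg : LipschitzWith Kg g)
    (hg₁ : ∀ x, ‖g x‖ = 1) :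
    ∃ G : X → WithLp 2 (V × ℝ), LipschitzWith (12 * K + 2 * Kg) G ∧ (∀ x, 1 / 4 ≤ ‖G x‖) ∧
      ∀ x, ‖F x‖ = 1 →
        (|(F x).snd| ≤ 1 / 2 → g x = NormedSpace.normalize (F x).fst) → G x = F x := by
  have hu : LipschitzWith K fun x => (F x).fst := .of_dist_le_mul fun x y =>
    (WithLp.dist_fst_le _ _).trans (hF.dist_le_mul x y)
  have hT : LipschitzWith K fun x => (F x).snd := .of_dist_le_mul fun x y =>
    (WithLp.dist_snd_le _ _).trans (hF.dist_le_mul x y)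
  obtain ⟨h, hh, hh_equator, hh_pole, hh_eq⟩ := exists_lipschitzWith_interpolation hu hT hg
    (fun x => (WithLp.norm_fst_le _ _).trans (hF₁ x)) hg₁
  refine ⟨fun x => WithLp.toLp 2 (h x, (F x).snd),
    (lipschitzWith_toLp_prod hh hT).weaken (le_of_eq (by ring)), fun x => ?_, fun x hx hgx => ?_⟩
  · have hfst : ‖h x‖ ≤ _ := WithLp.norm_fst_le _ (WithLp.toLp 2 (h x, (F x).snd))
    rcases le_total |(F x).snd| (1 / 4) with hT₀ | hT₀
    · linarith [hh_equator x hT₀]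
    · exact hT₀.trans (WithLp.norm_snd_le _ (WithLp.toLp 2 (h x, (F x).snd)))
  · have hfst : h x = (F x).fst := by
      rcases le_total (1 / 2) |(F x).snd| with hT₀ | hT₀
      · exact hh_pole x hT₀
      · exact hh_eq x (half_le_norm_fst_of_norm_eq_one hx hT₀) (hgx hT₀)
    simp only [hfst]
    rfl

/-- A map into the suspension has an extension `F = (u, T)` into the ball. Near the equator `u` is
replaced by the extension, to the smaller sphere, of its direction. -/
theorem LipschitzExtendsAt.sphere_prod [FiniteDimensional ℝ V] {C l : ℝ≥0}
    (hE : LipschitzExtendsAt X (Metric.sphere (0 : V) 1) C (4 * l)) :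
    LipschitzExtendsAt X (Metric.sphere (0 : WithLp 2 (V × ℝ)) 1)
      (192 * lipschitzExtensionConstant (WithLp 2 (V × ℝ)) + 64 * C) l := by
  intro A f hf
  obtain ⟨F, hF, hF₁, hFf⟩ := exists_lipschitzWith_extension_norm_le_one hf
  have hFA (a : X) (ha : a ∈ A) : ‖F a‖ = 1 := by
    simpa using congrArg norm (hFf ⟨a, ha⟩)
  have hu : LipschitzOnWith l (fun x => (F x).fst) {x ∈ A | |(F x).snd| ≤ 1 / 2} := by
    refine .of_dist_le_mul fun x hx y hy => (WithLp.dist_fst_le _ _).trans ?_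
    rw [hFf ⟨x, hx.1⟩, hFf ⟨y, hy.1⟩]
    exact hf.dist_le_mul ⟨x, hx.1⟩ ⟨y, hy.1⟩
  have hfour : 2 / (1 / 2) * l = 4 * l := by congr 1; norm_num
  obtain ⟨g, hg, hg₁, hgu⟩ := (hfour ▸ hE).exists_normalize_extension (m := 1 / 2) (by norm_num)
    hu fun x hx => by simpa using half_le_norm_fst_of_norm_eq_one (hFA x hx.1) hx.2
  obtain ⟨G, hG, hGm, hGF⟩ := exists_lipschitzWith_le_norm_of_suspension hF hF₁ hg hg₁
  obtain ⟨e, he, hef⟩ := exists_sphere_extension_of_le_norm (m := 1 / 4) (by norm_num) hG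
    (fun x => by simpa using hGm x)
    fun a => (hGF a (hFA a a.2) fun ha => hgu a ⟨a.2, ha⟩).trans (hFf a)
  refine ⟨e, he.weaken (le_of_eq ?_), hef⟩
  field_simp
  ring

end NormedSpace

theorem LipschitzExtendsAt.unitSphere_succ {n : ℕ} {C l : ℝ≥0}
    (hE : LipschitzExtendsAt X (UnitSphere n) C (4 * l)) :
    LipschitzExtendsAt X (UnitSphere (n + 1)) (192 * lipschitzExtensionConstant
      (WithLp 2 (EuclideanSpace ℝ (Fin (n + 1)) × ℝ)) + 64 * C) l :=
  hE.sphere_prod.sphere_congr_finrank <| by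
    rw [(WithLp.linearEquiv 2 ℝ (EuclideanSpace ℝ (Fin (n + 1)) × ℝ)).finrank_eq,
      Module.finrank_prod, finrank_euclideanSpace_fin, finrank_euclideanSpace_fin,
      Module.finrank_self]

end Suspension

section Heights

variable {X ι : Type*} [MetricSpace X] [Fintype ι] {s D C : ℝ≥0}

/-- The hyperplane of vectors whose coordinates sum to zero. -/
noncomputable def zeroSumHyperplane (ι : Type*) [Fintype ι] : Submodule ℝ (EuclideanSpace ℝ ι) :=
  (ℝ ∙ WithLp.toLp 2 (1 : ι → ℝ))ᗮ

theorem sum_eq_zero_of_mem_zeroSumHyperplane {v : EuclideanSpace ℝ ι}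
    (hv : v ∈ zeroSumHyperplane ι) : ∑ i, v i = 0 := by
  simpa [PiLp.inner_apply] using Submodule.mem_orthogonal_singleton_iff_inner_right.1 hv

theorem finrank_zeroSumHyperplane (n : ℕ) :
    Module.finrank ℝ (zeroSumHyperplane (Fin (n + 1))) = n :=
  have : Fact (Module.finrank ℝ (EuclideanSpace ℝ (Fin (n + 1))) = n + 1) :=
    ⟨finrank_euclideanSpace_fin⟩
  Submodule.finrank_orthogonal_span_singleton
    fun h => one_ne_zero (congrArg (fun v : EuclideanSpace ℝ (Fin (n + 1)) => v 0) h)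

theorem starProjection_zeroSumHyperplane_apply_sub (v : EuclideanSpace ℝ ι) (p q : ι) :
    (zeroSumHyperplane ι).starProjection v p - (zeroSumHyperplane ι).starProjection v q =
      v p - v q := by
  obtain ⟨c, hc⟩ := Submodule.mem_span_singleton.1
    (Submodule.starProjection_apply_mem (ℝ ∙ WithLp.toLp 2 (1 : ι → ℝ)) v)
  rw [zeroSumHyperplane, Submodule.starProjection_orthogonal_val, ← hc]
  simp

theorem exists_inv_card_le_sub_of_sum_eq_zero {v : EuclideanSpace ℝ ι} (hsum : ∑ i, v i = 0)
    (hv : ‖v‖ = 1) : ∃ p q, (Fintype.card ι : ℝ)⁻¹ ≤ v p - v q := by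
  have hne : (Finset.univ : Finset ι).Nonempty := by
    by_contra hempty
    have := norm_le_sum_norm_apply v
    rw [Finset.not_nonempty_iff_eq_empty.1 hempty, Finset.sum_empty, hv] at this
    linarith
  obtain ⟨i, -, hi⟩ : ∃ i ∈ Finset.univ, (Fintype.card ι : ℝ)⁻¹ ≤ ‖v i‖ := by
    refine Finset.exists_le_of_sum_le hne ?_
    rw [Finset.sum_const, nsmul_eq_mul, Finset.card_univ]
    exact mul_inv_le_one.trans (hv.ge.trans (norm_le_sum_norm_apply v))
  obtain ⟨p, -, hp⟩ : ∃ p ∈ Finset.univ, 0 ≤ v p :=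
    Finset.exists_le_of_sum_le hne (by rw [hsum, Finset.sum_const_zero])
  obtain ⟨q, -, hq⟩ : ∃ q ∈ Finset.univ, v q ≤ 0 :=
    Finset.exists_le_of_sum_le hne (by rw [hsum, Finset.sum_const_zero])
  rw [Real.norm_eq_abs] at hi
  rcases le_abs.1 hi with hi | hi
  · exact ⟨i, q, by linarith⟩
  · exact ⟨p, i, by linarith⟩

theorem half_le_norm_of_sub_eq_one {v : EuclideanSpace ℝ ι} {p q : ι} (h : v p - v q = 1) :
    1 / 2 ≤ ‖v‖ := by
  linarith [PiLp.norm_apply_le v p, PiLp.norm_apply_le v q, Real.le_norm_self (v p),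
    neg_le_of_abs_le (Real.norm_eq_abs (v q)).ge]

theorem LocalBump.lipschitzWith_toLp_weight (b : ι → LocalBump X s D) :
    LipschitzWith (Fintype.card ι * s⁻¹) fun x => WithLp.toLp 2 fun i => (b i).weight x := by
  refine LipschitzWith.of_dist_le_mul fun x y => ?_
  rw [dist_eq_norm]
  refine (norm_le_sum_norm_apply _).trans ?_
  calc ∑ i, ‖(b i).weight x - (b i).weight y‖ ≤ ∑ _i : ι, (s : ℝ)⁻¹ * dist x y :=
        Finset.sum_le_sum fun i _ => (b i).abs_weight_sub_le x y
    _ = (Fintype.card ι * s⁻¹ : ℝ≥0) * dist x y := by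
        rw [Finset.sum_const, nsmul_eq_mul, Finset.card_univ]
        push_cast
        ring

/-- The heights are the coordinates of a map to the unit sphere of the zero-sum hyperplane that
extends the direction of the projected weight vector from the set where some weight vanishes. -/
theorem LocalBump.exists_heights (b : ι → LocalBump X s D)
    (hb : ∀ x, ∃ i, (b i).weight x = 1)
    (hE : LipschitzExtendsAt X (Metric.sphere (0 : zeroSumHyperplane ι) 1) C
      (4 * (Fintype.card ι * s⁻¹))) :
    ∃ e : X → ι → ℝ, (∀ i, LipschitzWith (C * (4 * (Fintype.card ι * s⁻¹))) fun x => e x i) ∧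
      (∀ x, ∃ p q, (Fintype.card ι : ℝ)⁻¹ ≤ e x p - e x q) ∧
      ∀ x p q, e x q < e x p → 0 < (b p).weight x := by
  let w (x : X) : EuclideanSpace ℝ ι := WithLp.toLp 2 fun i => (b i).weight x
  let a (x : X) : zeroSumHyperplane ι := (zeroSumHyperplane ι).orthogonalProjectionOnto (w x)
  have ha_sub (x : X) (p q : ι) : (a x : EuclideanSpace ℝ ι) p - (a x : EuclideanSpace ℝ ι) q =
      (b p).weight x - (b q).weight x := starProjection_zeroSumHyperplane_apply_sub (w x) p q
  have ha : LipschitzWith (Fintype.card ι * s⁻¹) a := by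
    simpa only [one_mul, Function.comp_def] using
      ((zeroSumHyperplane ι).lipschitzWith_orthogonalProjectionOnto).comp
        (lipschitzWith_toLp_weight b)
  have hfour : 2 / (1 / 2) * (Fintype.card ι * s⁻¹) = 4 * (Fintype.card ι * s⁻¹) := by
    congr 1; norm_num
  obtain ⟨g, hg, hg₁, hga⟩ := (hfour ▸ hE).exists_normalize_extension (m := 1 / 2)
    (B := {x | ∃ i, (b i).weight x = 0}) (by norm_num) ha.lipschitzOnWith fun x ⟨q, hq⟩ => by
      obtain ⟨p, hp⟩ := hb x
      simpa using half_le_norm_of_sub_eq_one ((ha_sub x p q).trans (by rw [hp, hq, sub_zero]))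
  refine ⟨fun x => (g x : EuclideanSpace ℝ ι), fun i => ?_, fun x =>
    exists_inv_card_le_sub_of_sum_eq_zero (sum_eq_zero_of_mem_zeroSumHyperplane (g x).2) (hg₁ x),
    fun x p q hpq => ?_⟩
  · have hcoord : LipschitzWith 1 fun v : zeroSumHyperplane ι => (v : EuclideanSpace ℝ ι) i :=
      .mk_one fun v w => (PiLp.norm_apply_le (v - w : EuclideanSpace ℝ ι) i).trans_eq
        (dist_eq_norm v w).symm
    simpa only [hfour, one_mul, Function.comp_def] using hcoord.comp hg
  · refine ((b p).weight_nonneg x).lt_of_ne' fun hp => hpq.not_ge ?_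
    have hle := ha_sub x p q
    rw [hp, zero_sub] at hle
    simp only [hga x ⟨p, hp⟩, NormedSpace.normalize, Submodule.coe_smul, PiLp.smul_apply]
    exact smul_le_smul_of_nonneg_left (by linarith [(b q).weight_nonneg x]) (by positivity)

/-- Pigeonhole: the `card ι` numbers `⌊(v p - v j) / η⌋` cannot take all the values below `card ι`,
because the value at `q` is larger. -/
theorem exists_finset_gap {v : ι → ℝ} {η : ℝ} {p q : ι} (hη : 0 < η)
    (hpq : Fintype.card ι * η ≤ v p - v q) :
    ∃ J : Finset ι, p ∈ J ∧ q ∉ J ∧ ∀ i ∈ J, ∀ j ∉ J, η ≤ v i - v j := by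
  classical
  let level (j : ι) : ℕ := ⌊(v p - v j) / η⌋₊
  have hq : Fintype.card ι ≤ level q := Nat.le_floor ((le_div_iff₀ hη).2 hpq)
  have hcard : ((Finset.univ.erase q).image level).card < (Finset.range (Fintype.card ι)).card := by
    rw [Finset.card_range]
    exact Finset.card_image_le.trans_lt (Finset.card_erase_lt_of_mem (Finset.mem_univ q))
  obtain ⟨t, ht, ht_gap⟩ := Finset.exists_mem_notMem_of_card_lt_card hcard
  rw [Finset.mem_range] at ht
  have hne (j : ι) : level j ≠ t := by
    rintro rfl
    rcases eq_or_ne j q with rfl | hj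
    · exact hq.not_gt ht
    · exact ht_gap
        (Finset.mem_image_of_mem _ (Finset.mem_erase.2 ⟨hj, Finset.mem_univ j⟩))
  have hp : level p = 0 := by simp only [level, sub_self, zero_div, Nat.floor_zero]
  have ht₀ : t ≠ 0 := fun h => hne p (hp.trans h.symm)
  refine ⟨Finset.univ.filter fun j => level j < t, by simpa [hp] using ht₀.bot_lt,
    by simpa using ht.le.trans hq, fun i hi j hj => ?_⟩
  have hi' : v p - v i < t * η :=
    (div_lt_iff₀ hη).1 ((Nat.floor_lt' ht₀).1 (Finset.mem_filter.1 hi).2)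
  have hj' : ((t + 1 : ℕ) : ℝ) * η ≤ v p - v j := by
    refine (le_div_iff₀ hη).1 ((Nat.le_floor_iff' t.succ_ne_zero).1 ?_)
    exact (not_lt.1 fun h => hj (Finset.mem_filter.2 ⟨Finset.mem_univ j, h⟩)).lt_of_ne (hne j).symm
  push_cast at hj'
  linarith

end Heights

section GapCells

variable {X ι : Type*} [MetricSpace X] {s D K : ℝ≥0} {r η : ℝ} {b : ι → LocalBump X s D}
  {e : X → ι → ℝ} {J J' : Finset ι} {c c' : ι → X} {x y : X}

/-- The points where the heights `e x i` with `i ∈ J` exceed the other ones by at least `η`, and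
where the centers of the bumps in `J` are those prescribed by `c`. These cells, with `J` of
cardinality `i + 1`, form the `i`-th family of the reduced cover. -/
def gapCell (b : ι → LocalBump X s D) (e : X → ι → ℝ) (η : ℝ) (J : Finset ι) (c : ι → X) : Set X :=
  {x | (∀ p ∈ J, ∀ q ∉ J, η ≤ e x p - e x q) ∧ ∀ p ∈ J, (b p).center x = c p}

theorem weight_pos_of_mem_gapCell [Fintype ι] (hη : 0 < η) (hJ : J ≠ Finset.univ)
    (hpos : ∀ x p q, e x q < e x p → 0 < (b p).weight x) (hx : x ∈ gapCell b e η J c) {p : ι}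
    (hp : p ∈ J) : 0 < (b p).weight x := by
  obtain ⟨q, hq⟩ : ∃ q, q ∉ J := by simpa [Finset.eq_univ_iff_forall] using hJ
  exact hpos x p q (by linarith [hx.1 p hp q hq])

theorem le_dist_of_mem_gapCell_of_card_eq (hη : 0 < η)
    (he : ∀ i, LipschitzWith K fun x => e x i) (hr : K * r ≤ η) (hcard : J.card = J'.card)
    (hJ : J ≠ J') (hx : x ∈ gapCell b e η J c) (hy : y ∈ gapCell b e η J' c') :
    r ≤ dist x y := by
  obtain ⟨p, hp, hp'⟩ : ∃ p ∈ J, p ∉ J' :=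
    Finset.not_subset.1 fun h => hJ (Finset.eq_of_subset_of_card_le h hcard.ge)
  obtain ⟨q, hq', hq⟩ : ∃ q ∈ J', q ∉ J :=
    Finset.not_subset.1 fun h => hJ.symm (Finset.eq_of_subset_of_card_le h hcard.le)
  have hp_lip := (le_abs_self _).trans ((he p).dist_le_mul x y)
  have hq_lip := (neg_le_abs _).trans ((he q).dist_le_mul x y)
  have hK : η ≤ K * dist x y := by linarith [hx.1 p hp q hq, hy.1 q hq' p hp']
  exact le_of_mul_le_mul_left (hr.trans hK)
    (pos_of_mul_pos_left (hη.trans_le hK) dist_nonneg)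

theorem le_dist_of_mem_gapCell_of_ne
    (hJ : ∀ ⦃z c⦄, z ∈ gapCell b e η J c → ∀ p ∈ J, 0 < (b p).weight z)
    (hne : gapCell b e η J c ≠ gapCell b e η J c') (hx : x ∈ gapCell b e η J c)
    (hy : y ∈ gapCell b e η J c') : s ≤ dist x y := by
  by_contra! hxy
  refine hne (Set.ext fun z => and_congr_right fun _ => forall₂_congr fun p hp => ?_)
  rw [← hx.2 p hp, ← hy.2 p hp, (b p).center_eq (hJ hx p hp) (hJ hy p hp) hxy]

theorem dist_le_of_mem_gapCell {p : ι} (hx : x ∈ gapCell b e η J c) (hy : y ∈ gapCell b e η J c)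
    (hp : p ∈ J) (hxp : 0 < (b p).weight x) (hyp : 0 < (b p).weight y) : dist x y ≤ 2 * D := by
  have hx' := (b p).dist_center_le hxp
  have hy' := (b p).dist_center_le hyp
  rw [hx.2 p hp] at hx'
  rw [hy.2 p hp] at hy'
  linarith [dist_triangle_right x y (c p)]

theorem hasColoredCover_of_heights [Fintype ι] {k : ℕ} (hk : Fintype.card ι = k + 2) (hη : 0 < η)
    (he : ∀ i, LipschitzWith K fun x => e x i)
    (hgap : ∀ x, ∃ p q, Fintype.card ι * η ≤ e x p - e x q)
    (hpos : ∀ x p q, e x q < e x p → 0 < (b p).weight x) (hrs : r ≤ s) (hr : K * r ≤ η) :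
    HasColoredCover X k r (2 * D) := by
  have hproper {i : Fin (k + 1)} {J : Finset ι} (hJ : J.card = i + 1) : J ≠ Finset.univ := by
    rintro rfl
    rw [Finset.card_univ] at hJ
    omega
  refine ⟨fun i => {U | ∃ (J : Finset ι) (c : ι → X), J.card = i + 1 ∧ U = gapCell b e η J c},
    fun x => ?_, ?_, ?_⟩
  · obtain ⟨p, q, hpq⟩ := hgap x
    obtain ⟨J, hp, hq, hJ⟩ := exists_finset_gap hη hpq
    have hJ_lt : J.card < k + 2 := hk ▸ Finset.card_lt_univ_of_notMem hq
    have hJ_pos : 0 < J.card := Finset.card_pos.2 ⟨p, hp⟩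
    exact ⟨⟨J.card - 1, by omega⟩, _, ⟨J, fun p => (b p).center x, by simp only; omega, rfl⟩,
      hJ, fun _ _ => rfl⟩
  · rintro i _ ⟨J, c, hJ, rfl⟩ _ ⟨J', c', hJ', rfl⟩ hne x hx y hy
    rcases eq_or_ne J J' with rfl | hJJ'
    · exact hrs.trans (le_dist_of_mem_gapCell_of_ne
        (fun _ _ hz _ => weight_pos_of_mem_gapCell hη (hproper hJ) hpos hz) hne hx hy)
    · exact le_dist_of_mem_gapCell_of_card_eq hη he hr (hJ.trans hJ'.symm) hJJ' hx hy
  · rintro i _ ⟨J, c, hJ, rfl⟩ x hx y hy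
    obtain ⟨p, hp⟩ : J.Nonempty := Finset.card_pos.1 (by omega)
    exact dist_le_of_mem_gapCell hx hy hp (weight_pos_of_mem_gapCell hη (hproper hJ) hpos hx hp)
      (weight_pos_of_mem_gapCell hη (hproper hJ) hpos hy hp)

end GapCells

section Scales

variable {X E : Type*} [MetricSpace X] [MetricSpace E] {n : ℕ} {𝓕 : Filter ℝ≥0}

theorem HasColoredCover.mono_left {k : ℕ} {r D : ℝ} (hnk : n ≤ k) (h : HasColoredCover X n r D) :
    HasColoredCover X k r D := by
  obtain ⟨𝒰, hcover, hdisj, hdiam⟩ := h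
  refine ⟨fun i => 𝒰 (Fin.clamp i n), fun x => ?_, fun i => hdisj _, fun i => hdiam _⟩
  obtain ⟨i, hi⟩ := hcover x
  have hclamp : Fin.clamp (Fin.castLE (Nat.succ_le_succ hnk) i) n = i :=
    Fin.ext (min_eq_left (Nat.lt_succ_iff.1 i.2))
  exact ⟨Fin.castLE (Nat.succ_le_succ hnk) i, by simpa only [hclamp] using hi⟩

/-- A filter of positive scales that is invariant under rescaling. Small scales are `𝓝[>] 0`, large
scales are `atTop`. -/
structure IsScaleFilter (𝓕 : Filter ℝ≥0) : Prop where
  eventually_pos : ∀ᶠ r in 𝓕, 0 < r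
  tendsto_const_mul : ∀ ⦃a : ℝ≥0⦄, 0 < a → Tendsto (a * ·) 𝓕 𝓕

/-- The common form of the two dimensions: colored covers of linearly bounded diameter at all the
scales of `𝓕`. -/
def ScaleDimLE (𝓕 : Filter ℝ≥0) (X : Type*) [MetricSpace X] (n : ℕ) : Prop :=
  ∃ C : ℝ≥0, 0 < C ∧ ∀ᶠ r : ℝ≥0 in 𝓕, HasColoredCover X n r (C * r)

/-- The common form of the two notions of Lipschitz extensor. A scale `r` corresponds to the
Lipschitz constant `r⁻¹`. -/
def IsScaleLipschitzExtensor (𝓕 : Filter ℝ≥0) (E X : Type*) [MetricSpace E] [MetricSpace X] :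
    Prop :=
  ∃ C : ℝ≥0, 0 < C ∧ ∀ᶠ r in 𝓕, LipschitzExtendsAt X E C r⁻¹

theorem isScaleFilter_nhdsGT_zero : IsScaleFilter (𝓝[>] 0) where
  eventually_pos := self_mem_nhdsWithin
  tendsto_const_mul a ha := by
    refine tendsto_nhdsWithin_iff.2 ⟨?_, eventually_mem_nhdsWithin.mono fun r hr => mul_pos ha hr⟩
    exact ((continuous_const_mul a).tendsto' 0 0 (mul_zero a)).mono_left nhdsWithin_le_nhds

theorem isScaleFilter_atTop : IsScaleFilter atTop where
  eventually_pos := eventually_gt_atTop 0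
  tendsto_const_mul _ ha := tendsto_id.const_mul_atTop ha

theorem capacityDimLE_iff : CapacityDimLE X n ↔ ScaleDimLE (𝓝[>] 0) X n := by
  simp only [ScaleDimLE, (nhdsGT_basis (0 : ℝ≥0)).eventually_iff]
  constructor
  · rintro ⟨C, hC, r₀, hr₀, h⟩
    lift C to ℝ≥0 using hC.le
    lift r₀ to ℝ≥0 using hr₀.le
    exact ⟨C, hC, r₀, hr₀, fun r hr => h r hr.1 hr.2⟩
  · rintro ⟨C, hC, r₀, hr₀, h⟩
    refine ⟨C, hC, r₀, hr₀, fun r hr hr' => ?_⟩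
    lift r to ℝ≥0 using hr.le
    exact h ⟨hr, hr'⟩

theorem higsonAsdimLE_iff : HigsonAsdimLE X n ↔ ScaleDimLE atTop X n := by
  simp only [ScaleDimLE, (atTop_basis_Ioi' (0 : ℝ≥0)).eventually_iff]
  constructor
  · rintro ⟨C, hC, r₀, hr₀, h⟩
    lift C to ℝ≥0 using hC.le
    lift r₀ to ℝ≥0 using hr₀.le
    exact ⟨C, hC, r₀, hr₀, fun r hr => h r hr⟩
  · rintro ⟨C, hC, r₀, hr₀, h⟩
    refine ⟨C, hC, r₀, hr₀, fun r hr => ?_⟩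
    lift r to ℝ≥0 using r₀.coe_nonneg.trans hr.le
    exact h hr

theorem isSmallScaleLipschitzExtensor_iff :
    IsSmallScaleLipschitzExtensor E X ↔ IsScaleLipschitzExtensor (𝓝[>] 0) E X := by
  simp only [IsScaleLipschitzExtensor, (nhdsGT_basis (0 : ℝ≥0)).eventually_iff]
  constructor
  · rintro ⟨C, M, hC, hM, h⟩
    exact ⟨C, hC, M⁻¹, inv_pos.2 hM, fun r hr => h _ ((lt_inv_comm₀ hM hr.1).2 hr.2)⟩
  · rintro ⟨C, hC, r₀, hr₀, h⟩
    refine ⟨C, r₀⁻¹, hC, inv_pos.2 hr₀, fun l hl => ?_⟩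
    have hl₀ : 0 < l := (inv_pos.2 hr₀).trans hl
    simpa only [inv_inv] using h ⟨inv_pos.2 hl₀, (inv_lt_comm₀ hr₀ hl₀).1 hl⟩

theorem lipschitzExtendsAt_zero [Nonempty E] (C : ℝ≥0) : LipschitzExtendsAt X E C 0 := by
  intro A f hf
  have hconst (a b : A) : f a = f b := dist_le_zero.1 (by simpa using hf.dist_le_mul a b)
  obtain ⟨c, hc⟩ : ∃ c, ∀ a, c = f a := by
    rcases isEmpty_or_nonempty A with hA | ⟨⟨a⟩⟩
    · exact ⟨Classical.arbitrary E, fun a => hA.elim a⟩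
    · exact ⟨f a, hconst a⟩
  exact ⟨fun _ => c, .const' c, hc⟩

theorem isLargeScaleLipschitzExtensor_iff [Nonempty E] :
    IsLargeScaleLipschitzExtensor E X ↔ IsScaleLipschitzExtensor atTop E X := by
  simp only [IsScaleLipschitzExtensor, (atTop_basis_Ioi' (0 : ℝ≥0)).eventually_iff]
  constructor
  · rintro ⟨C, M, hC, hM, h⟩
    exact ⟨C, hC, M⁻¹, inv_pos.2 hM, fun r hr => h _ (inv_lt_of_inv_lt₀ hM hr)⟩
  · rintro ⟨C, hC, r₀, hr₀, h⟩
    refine ⟨C, r₀⁻¹, hC, inv_pos.2 hr₀, fun l hl => ?_⟩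
    rcases eq_zero_or_pos l with rfl | hl₀
    · exact lipschitzExtendsAt_zero C
    · simpa only [inv_inv] using h ((lt_inv_comm₀ hl₀ hr₀).1 hl)

theorem ScaleDimLE.isScaleLipschitzExtensor (h𝓕 : IsScaleFilter 𝓕) (h : ScaleDimLE 𝓕 X n) :
    IsScaleLipschitzExtensor 𝓕 (UnitSphere n) X := by
  obtain ⟨C₀, -, hcover⟩ := h
  set K : ℝ≥0 := 2 * lipschitzExtensionConstant (EuclideanSpace ℝ (Fin (n + 1)))
  have hK : 0 < K := mul_pos two_pos (lipschitzExtensionConstant_pos _)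
  set κ : ℝ≥0 := 8 * K * (C₀ * 3 + 1)
  have hκ : 0 < κ := by positivity
  obtain ⟨C, hC, hextends⟩ := exists_lipschitzExtendsAt_sphere_of_localBump (X := X)
    (Fin (n + 1)) κ
  refine ⟨C, hC, ?_⟩
  filter_upwards [h𝓕.eventually_pos,
    (h𝓕.tendsto_const_mul (by positivity : 0 < 3 * κ⁻¹)).eventually hcover] with r hr hr_cover
  have hs : 0 < κ⁻¹ * r := mul_pos (inv_pos.2 hκ) hr
  obtain ⟨b, hb⟩ := HasColoredCover.exists_localBump (D := C₀ * (3 * κ⁻¹ * r)) hs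
    (by simpa [mul_assoc] using hr_cover)
  refine hextends r⁻¹ _ _ b hs le_add_self (by rw [mul_inv, inv_inv]) ?_ hb
  calc 8 * (K * r⁻¹) * (C₀ * (3 * κ⁻¹ * r) + κ⁻¹ * r)
      = κ * κ⁻¹ * (r⁻¹ * r) := by ring
    _ ≤ 1 := by rw [mul_inv_cancel₀ hκ.ne', inv_mul_cancel₀ hr.ne', one_mul]

theorem HasColoredCover.of_lipschitzExtendsAt_unitSphere {s D C r : ℝ≥0} (hs : 0 < s)
    (h : HasColoredCover X (n + 1) (3 * s) D)
    (hE : LipschitzExtendsAt X (UnitSphere n) C (4 * ((n + 2) * s⁻¹))) (hrs : r ≤ s)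
    (hr : C * (4 * ((n + 2) * s⁻¹)) * r ≤ ((n + 2 : ℝ≥0) ^ 2)⁻¹) :
    HasColoredCover X n r (2 * (D + s)) := by
  obtain ⟨b, hb⟩ := h.exists_localBump hs
  have hcard : Fintype.card (Fin (n + 1 + 1)) = n + 2 := Fintype.card_fin _
  obtain ⟨e, he, hgap, hpos⟩ := LocalBump.exists_heights b hb (C := C) <| by
    rw [hcard]
    exact_mod_cast hE.sphere_congr_finrank
      (finrank_euclideanSpace_fin.trans (finrank_zeroSumHyperplane (n + 1)).symm)
  rw [hcard] at he
  refine mod_cast hasColoredCover_of_heights hcard (η := (((n + 2) ^ 2)⁻¹ : ℝ≥0))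
    (by positivity) he (fun x => ?_) hpos hrs (mod_cast hr)
  obtain ⟨p, q, hpq⟩ := hgap x
  refine ⟨p, q, le_trans (le_of_eq ?_) hpq⟩
  rw [hcard]
  push_cast
  field_simp

theorem ScaleDimLE.of_succ (h𝓕 : IsScaleFilter 𝓕) (h : ScaleDimLE 𝓕 X (n + 1))
    (hE : IsScaleLipschitzExtensor 𝓕 (UnitSphere n) X) : ScaleDimLE 𝓕 X n := by
  obtain ⟨C₀, -, hcover⟩ := h
  obtain ⟨C, -, hextends⟩ := hE
  set c : ℝ≥0 := 1 + 4 * C * (n + 2) ^ 3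
  have hc : 0 < c := by positivity
  refine ⟨2 * (C₀ * 3 + 1) * c, by positivity, ?_⟩
  filter_upwards [h𝓕.eventually_pos,
    (h𝓕.tendsto_const_mul (by positivity : 0 < 3 * c)).eventually hcover,
    (h𝓕.tendsto_const_mul (by positivity : 0 < (4 * (n + 2 : ℝ≥0))⁻¹ * c)).eventually hextends]
    with r hr hr_cover hr_extends
  have hs : 0 < c * r := mul_pos hc hr
  have hscale : ((4 * (n + 2 : ℝ≥0))⁻¹ * c * r)⁻¹ = 4 * ((n + 2) * (c * r)⁻¹) := by
    simp only [mul_inv, inv_inv]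
    ring
  have hr_gap : C * (4 * ((n + 2) * (c * r)⁻¹)) * r ≤ ((n + 2 : ℝ≥0) ^ 2)⁻¹ := by
    rw [inv_eq_one_div ((n + 2 : ℝ≥0) ^ 2), le_div_iff₀ (by positivity)]
    calc C * (4 * ((n + 2) * (c * r)⁻¹)) * r * (n + 2) ^ 2
        = 4 * C * (n + 2) ^ 3 / c := by field_simp
      _ ≤ 1 := div_le_one_of_le₀ le_add_self zero_le
  have hcover' := HasColoredCover.of_lipschitzExtendsAt_unitSphere
    (D := C₀ * (3 * c * r)) hs (by simpa [mul_assoc] using hr_cover) (hscale ▸ hr_extends)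
    (le_mul_of_one_le_left zero_le le_self_add) hr_gap
  convert hcover' using 1
  push_cast
  ring

theorem IsScaleLipschitzExtensor.unitSphere_succ (h𝓕 : IsScaleFilter 𝓕)
    (h : IsScaleLipschitzExtensor 𝓕 (UnitSphere n) X) :
    IsScaleLipschitzExtensor 𝓕 (UnitSphere (n + 1)) X := by
  obtain ⟨C, hC, hextends⟩ := h
  refine ⟨_, add_pos_of_nonneg_of_pos zero_le (mul_pos (by norm_num) hC),
    ((h𝓕.tendsto_const_mul (by norm_num : (0 : ℝ≥0) < 4⁻¹)).eventually hextends).mono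
      fun r hr => LipschitzExtendsAt.unitSphere_succ ?_⟩
  simpa only [mul_inv, inv_inv] using hr

theorem mainTheorem2_general {𝓕 : Filter ℝ≥0} (h𝓕 : IsScaleFilter 𝓕) (X : Type*) [MetricSpace X]
    (n : ℕ) (hfin : ∃ k, ScaleDimLE 𝓕 X k) :
    IsScaleLipschitzExtensor 𝓕 (UnitSphere n) X ↔ ScaleDimLE 𝓕 X n := by
  refine ⟨fun hE => ?_, fun h => h.isScaleLipschitzExtensor h𝓕⟩
  obtain ⟨k, C, hC, hcover⟩ := hfin
  have hE_add (j : ℕ) : IsScaleLipschitzExtensor 𝓕 (UnitSphere (n + j)) X := by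
    induction j with
    | zero => exact hE
    | succ j ih => exact ih.unitSphere_succ h𝓕
  have hdim : ScaleDimLE 𝓕 X (n + k) :=
    ⟨C, hC, hcover.mono fun r hr => hr.mono_left (Nat.le_add_left k n)⟩
  clear hcover
  induction k with
  | zero => exact hdim
  | succ k ih => exact ih (hdim.of_succ h𝓕 (hE_add k))

end Scales

theorem mainTheorem2 (X : Type*) [MetricSpace X] (n : ℕ) :
    ((∃ k : ℕ, CapacityDimLE X k) →
      (IsSmallScaleLipschitzExtensor (UnitSphere n) X ↔ CapacityDimLE X n)) ∧
    ((∃ k : ℕ, HigsonAsdimLE X k) →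
      (IsLargeScaleLipschitzExtensor (UnitSphere n) X ↔ HigsonAsdimLE X n)) := by
  have : Nonempty (UnitSphere n) := (NormedSpace.sphere_nonempty.2 zero_le_one).to_subtype
  simp only [capacityDimLE_iff, higsonAsdimLE_iff, isSmallScaleLipschitzExtensor_iff,
    isLargeScaleLipschitzExtensor_iff]
  exact ⟨mainTheorem2_general isScaleFilter_nhdsGT_zero X n,
    mainTheorem2_general isScaleFilter_atTop X n⟩
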